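/- **Theorem 1.** Let $r\ge 1$ and, for every prime $p$, let $M(p)$ be a complex $r\times r$ matrix which is unitary for all $p$ outside a finite (possibly empty) set and is $0$ at the remaining primes (i.e. the Euler factor there is omitted). For $\Re(s)>1$ put $$L(s,M)=\prod_{p}\det\bigl(1-M(p)p^{-s}\bigr)^{-1},\qquad L(s,M^2)=\prod_{p}\det\bigl(1-M(p)^2p^{-s}\bigr)^{-1}.$$ Assume that $L(s,M)$ continues to an entire function with $L(\tfrac12,M)\neq 0$, and that $L(s,M^2)$ continues to a function meromorphic at $s=1$. Let $\delta(M)\in\mathbb Z$ be the order of the pole of $L(s,M^2)$ at $s=1$ (a zero of order $k$ counting as a pole of order $-k$). Assume the Deep Riemann Hypothesis for $L(s,M)$: $$\lim_{x\to\infty}\prod_{p\le x}\det\bigl(1-M(p)p^{-1/2}\bigr)^{-1}=\sqrt2^{\,\delta(M)}\,L(\tfrac12,M).$$ Then $$\lim_{x\to\infty}\frac{\sum_{p\le x}\operatorname{tr}(M(p))/\sqrt p}{\log\log x}=-\frac{\delta(M)}2 .$$ No functional equation for $L(s,M)$ has to be assumed. -/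

import Mathlib

open Filter Topology

noncomputable section

namespace DRH

/-- A family of `r × r` matrices attached to the primes (the values of `M` at non-primes are never
used): `M p` is unitary for all primes `p` outside a finite, possibly empty, set; at the finitely
many exceptional primes the Euler factor is omitted, i.e. `M p = 0`. -/
structure IsUnitaryFamily {r : ℕ} (M : ℕ → Matrix (Fin r) (Fin r) ℂ) : Prop where
  unitary_or_zero : ∀ p : ℕ, p.Prime → M p ∈ Matrix.unitaryGroup (Fin r) ℂ ∨ M p = 0
  finite_exceptional : {p : ℕ | p.Prime ∧ M p ∉ Matrix.unitaryGroup (Fin r) ℂ}.Finite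

/-- The Euler factor `det (1 - M(p) p^{-s})⁻¹`. -/
def eulerFactor {r : ℕ} (M : ℕ → Matrix (Fin r) (Fin r) ℂ) (s : ℂ) (p : ℕ) : ℂ :=
  ((1 - (p : ℂ) ^ (-s) • M p).det)⁻¹

/-- The Euler product `∏_p det (1 - M(p) p^{-s})⁻¹` over all primes. For a unitary family it
converges absolutely when `1 < re s`, and it is used for such `s` only. -/
def eulerProduct {r : ℕ} (M : ℕ → Matrix (Fin r) (Fin r) ℂ) (s : ℂ) : ℂ :=
  ∏' p : Nat.Primes, eulerFactor M s p

/-- The finite Euler product over the primes `p ≤ x`. -/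
def partialEulerProduct {r : ℕ} (M : ℕ → Matrix (Fin r) (Fin r) ℂ) (s : ℂ) (x : ℝ) : ℂ :=
  ∏ p ∈ Nat.primesBelow (⌊x⌋₊ + 1), eulerFactor M s p

/-- `L` is an analytic continuation of `L(s, M)` to an entire function. -/
structure IsEntireContinuation {r : ℕ} (M : ℕ → Matrix (Fin r) (Fin r) ℂ) (L : ℂ → ℂ) :
    Prop where
  differentiable : Differentiable ℂ L
  eq_eulerProduct : ∀ s : ℂ, 1 < s.re → L s = eulerProduct M s

/-- `L` is a continuation of `L(s, M)` which is meromorphic at `s = 1`. -/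
structure IsMeromorphicContinuationAtOne {r : ℕ} (M : ℕ → Matrix (Fin r) (Fin r) ℂ)
    (L : ℂ → ℂ) : Prop where
  meromorphicAt : MeromorphicAt L 1
  eq_eulerProduct : ∀ s : ℂ, 1 < s.re → L s = eulerProduct M s

/-- The order of the pole of `f` at `z`: positive at a pole, `-k` at a zero of order `k`.
(For a function vanishing identically near `z` the value is the default `0`.) -/
def poleOrderAt (f : ℂ → ℂ) (z : ℂ) : ℤ :=
  -(meromorphicOrderAt f z).untop₀

/-- The Deep Riemann Hypothesis for `L(s, M)`, where `L` is the continuation of `L(s, M)` and `L₂`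
the continuation of `L(s, M²)`: the Euler product converges at `s = 1/2`, with limit
`√2 ^ δ(M) * L(1/2, M)`, where `δ(M)` is the order of the pole of `L(s, M²)` at `s = 1`. -/
def DeepRiemannHypothesis {r : ℕ} (M : ℕ → Matrix (Fin r) (Fin r) ℂ) (L L₂ : ℂ → ℂ) : Prop :=
  Tendsto (fun x : ℝ => partialEulerProduct M (1 / 2) x) atTop
    (𝓝 (((Real.sqrt 2 : ℝ) : ℂ) ^ (poleOrderAt L₂ 1) * L (1 / 2)))

end DRH

end

/-!
Write `a(p) = tr M(p)` and `b(p) = tr M(p)²`, and let `ℓ(p, s)` be the logarithm of the Euler factor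
of `L(s, M)` obtained by summing the principal logarithms over the eigenvalues. As the eigenvalues
have absolute value at most one, `ℓ(p, 1/2) = a(p)/√p + b(p)/(2p) + O(p^(-3/2))`, so that
`∑_{p ≤ x} a(p)/√p = ∑_{p ≤ x} ℓ(p, 1/2) - (1/2) ∑_{p ≤ x} b(p)/p + O(1)`.

* The exponentials of the sums `∑_{p ≤ n} ℓ(p, 1/2)` are the partial Euler products, which converge
  to a nonzero limit by the Deep Riemann Hypothesis. The increments of the sums tend to zero, so the
  sums eventually stay on one branch of the logarithm, and they are bounded
  (`exists_norm_le_of_tendsto_exp`).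

* `∑_{p ≤ x} b(p)/p = δ log log x + O(1)` (`exists_norm_sum_trace_div_sub_le`). No Tauberian theorem
  is needed, because the `b(p)` are bounded: with `t = 1 / log x`, the sum differs from
  `∑_p b(p) p^(-1-t)` by a bounded amount (`exists_norm_tsum_sub_sum_le`), since the weights differ
  by at most `3 t (log p) p^(-1-t)` at each prime, and `∑_p (log p) p^(-1-t) = O(1/t)` by the simple
  pole of `-ζ'/ζ` at `1`. And `∑_p b(p) p^(-1-t)` is within `O(1)` of a continuous logarithm of
  `L(1 + t, M²) = t^(-δ) g(1 + t)`, where `g` is analytic and `g(1) ≠ 0`; that logarithm is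
  `-δ log t + O(1)` (`exists_eventually_norm_le_of_tendsto_exp`).

Together, `∑_{p ≤ x} a(p)/√p = -(δ/2) log log x + O(1)`.
-/

namespace DRH

/-! ### Eigenvalues of unitary matrices -/

lemma norm_eq_one_of_isRoot_charpoly {r : ℕ} {A : Matrix (Fin r) (Fin r) ℂ}
    (hA : A ∈ Matrix.unitaryGroup (Fin r) ℂ) {z : ℂ} (hz : A.charpoly.IsRoot z) : ‖z‖ = 1 := by
  have hdet : (Matrix.scalar (Fin r) z - A).det = 0 := by
    rw [← Matrix.eval_charpoly]; exact hz
  obtain ⟨v, hv, hAv⟩ := Matrix.exists_mulVec_eq_zero_iff.mpr hdet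
  have hAv' : A.mulVec v = z • v := by
    have : Matrix.scalar (Fin r) z = z • (1 : Matrix (Fin r) (Fin r) ℂ) := by
      ext i j; simp [Matrix.one_apply, Matrix.diagonal_apply]
    rw [this, Matrix.sub_mulVec, Matrix.smul_mulVec, Matrix.one_mulVec, sub_eq_zero] at hAv
    exact hAv.symm
  have hinner : dotProduct (star (A.mulVec v)) (A.mulVec v) = dotProduct (star v) v := by
    rw [Matrix.star_mulVec, ← Matrix.dotProduct_mulVec, Matrix.mulVec_mulVec,
      ← Matrix.star_eq_conjTranspose, Unitary.star_mul_self_of_mem hA, Matrix.one_mulVec]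
  rw [hAv', star_smul, smul_dotProduct, dotProduct_smul, smul_eq_mul, smul_eq_mul, ← mul_assoc]
    at hinner
  have hv0 : dotProduct (star v) v ≠ 0 := by
    open ComplexOrder in exact mt dotProduct_star_self_eq_zero.mp hv
  have h1 : star z * z = 1 := mul_right_cancel₀ hv0 (by rw [hinner, one_mul])
  have h2 : ((‖z‖ ^ 2 : ℝ) : ℂ) = 1 := by
    rw [← h1, mul_comm]
    exact_mod_cast (Complex.mul_conj' z).symm
  have h3 : ‖z‖ ^ 2 = 1 := by exact_mod_cast h2
  nlinarith [norm_nonneg z]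

/-- The eigenvalues, with multiplicity, of a matrix that is unitary or zero. That the eigenvalues of
`A ^ 2` are the squares of those of `A` follows from `det (w² - A²) = det (w - A) det (w + A)`. -/
lemma exists_eigenvalues {r : ℕ} {A : Matrix (Fin r) (Fin r) ℂ}
    (hA : A ∈ Matrix.unitaryGroup (Fin r) ℂ ∨ A = 0) :
    ∃ e : Fin r → ℂ, (∀ i, ‖e i‖ ≤ 1) ∧ A.trace = ∑ i, e i ∧ (A ^ 2).trace = ∑ i, e i ^ 2 ∧
      ∀ z : ℂ, (1 - z • A).det = ∏ i, (1 - z * e i) := by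
  rcases hA with hA | rfl
  swap
  · exact ⟨0, by simp⟩
  have hcard : Multiset.card A.charpoly.roots = r := by
    rw [← (IsAlgClosed.splits A.charpoly).natDegree_eq_card_roots, Matrix.charpoly_natDegree_eq_dim,
      Fintype.card_fin]
  obtain ⟨e, he⟩ : ∃ e : Fin r → ℂ, A.charpoly.roots = Multiset.map e Finset.univ.val := by
    obtain ⟨l, hl⟩ : ∃ l : List ℂ, A.charpoly.roots = l := ⟨_, (Multiset.coe_toList _).symm⟩
    have hlen : l.length = r := by rw [← hcard, hl, Multiset.coe_card]
    subst hlen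
    refine ⟨l.get, ?_⟩
    rw [hl, Fin.univ_val_map, List.ofFn_get]
  have heval (w : ℂ) : (Matrix.scalar (Fin r) w - A).det = ∏ i, (w - e i) := by
    rw [← Matrix.eval_charpoly, (IsAlgClosed.splits A.charpoly).eq_prod_roots_of_monic
      A.charpoly_monic, he, Multiset.map_map, Polynomial.eval_multiset_prod, Multiset.map_map]
    simp [Finset.prod]
  have hsc (w : ℂ) : Matrix.scalar (Fin r) w = w • (1 : Matrix (Fin r) (Fin r) ℂ) := by
    ext i j; simp [Matrix.one_apply, Matrix.diagonal_apply]
  have hsq : (A ^ 2).charpoly = ∏ i, (Polynomial.X - Polynomial.C (e i ^ 2)) := by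
    refine Polynomial.funext fun y ↦ ?_
    obtain ⟨w, rfl⟩ := IsSquare.exists_sq y (IsAlgClosed.exists_pow_nat_eq y two_pos |>.elim
      fun w hw ↦ ⟨w, by rw [← hw, sq]⟩)
    have hfac : Matrix.scalar (Fin r) (w ^ 2) - A ^ 2 =
        (Matrix.scalar (Fin r) w - A) * -(Matrix.scalar (Fin r) (-w) - A) := by
      simp only [hsc]
      simp only [mul_neg, mul_sub, sub_mul, smul_mul_assoc, mul_smul_comm, one_mul, mul_one, sq,
        smul_sub, smul_smul, neg_smul, mul_neg]
      abel
    rw [Matrix.eval_charpoly, hfac, Matrix.det_mul, Matrix.det_neg, heval, heval,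
      Polynomial.eval_prod, ← Finset.card_univ, ← Finset.prod_const, ← Finset.prod_mul_distrib,
      ← Finset.prod_mul_distrib]
    refine Finset.prod_congr rfl fun i _ ↦ ?_
    simp only [Polynomial.eval_sub, Polynomial.eval_X, Polynomial.eval_C]
    ring
  refine ⟨e, fun i ↦ ?_, ?_, ?_, fun z ↦ ?_⟩
  · refine (norm_eq_one_of_isRoot_charpoly hA (Polynomial.isRoot_of_mem_roots ?_)).le
    rw [he]
    exact Multiset.mem_map_of_mem e (Finset.mem_univ i)
  · rw [Matrix.trace_eq_sum_roots_charpoly, he]; rfl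
  · have hroots : (A ^ 2).charpoly.roots = Finset.univ.val.map fun i ↦ e i ^ 2 := by
      rw [hsq, ← Polynomial.roots_multiset_prod_X_sub_C (Finset.univ.val.map fun i ↦ e i ^ 2),
        Multiset.map_map]
      rfl
    rw [Matrix.trace_eq_sum_roots_charpoly, hroots]; rfl
  · rcases eq_or_ne z 0 with rfl | hz
    · simp
    · have : (1 : Matrix (Fin r) (Fin r) ℂ) - z • A = z • (Matrix.scalar (Fin r) z⁻¹ - A) := by
        rw [hsc, smul_sub, smul_smul, mul_inv_cancel₀ hz, one_smul]
      rw [this, Matrix.det_smul, heval, ← Finset.card_univ, ← Finset.prod_const,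
        ← Finset.prod_mul_distrib]
      refine Finset.prod_congr rfl fun i _ ↦ ?_
      rw [mul_sub, mul_inv_cancel₀ hz]

lemma IsUnitaryFamily.sq {r : ℕ} {M : ℕ → Matrix (Fin r) (Fin r) ℂ} (hM : IsUnitaryFamily M)
    {p : ℕ} (hp : p.Prime) : M p ^ 2 ∈ Matrix.unitaryGroup (Fin r) ℂ ∨ M p ^ 2 = 0 :=
  (hM.unitary_or_zero p hp).imp (fun h ↦ pow_mem h 2) fun h ↦ by rw [h, zero_pow two_ne_zero]

/-! ### Boundedness of continuous logarithms -/

/-- A sequence of logarithms of a sequence with nonzero limit is bounded if its increments tend to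
zero: the error to the principal branch is eventually a constant. -/
lemma exists_norm_le_of_tendsto_exp {S : ℕ → ℂ} {c : ℂ} (hc : c ≠ 0)
    (hS : Tendsto (fun n ↦ Complex.exp (S n)) atTop (𝓝 c))
    (hd : Tendsto (fun n ↦ S (n + 1) - S n) atTop (𝓝 0)) : ∃ B : ℝ, ∀ n, ‖S n‖ ≤ B := by
  have hP : Tendsto (fun n ↦ Complex.exp (S n) / c) atTop (𝓝 1) := by
    simpa [hc] using hS.div_const c
  have hlog : Tendsto (fun n ↦ Complex.log (Complex.exp (S n) / c)) atTop (𝓝 0) := by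
    simpa using hP.clog (by simp)
  -- `H` is `S` moved by the principal logarithm that makes `exp (H n)` exactly `c`.
  set H : ℕ → ℂ := fun n ↦ S n - Complex.log (Complex.exp (S n) / c) with hH
  have hexp (n) : Complex.exp (H n) = c := by
    have : Complex.exp (S n) / c ≠ 0 := div_ne_zero (Complex.exp_ne_zero _) hc
    rw [hH, Complex.exp_sub, Complex.exp_log this]
    field_simp [Complex.exp_ne_zero (S n)]
  have hHd : Tendsto (fun n ↦ H (n + 1) - H n) atTop (𝓝 0) := by
    have := hd.sub ((hlog.comp (tendsto_add_atTop_nat 1)).sub hlog)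
    simp only [sub_zero] at this
    refine this.congr fun n ↦ ?_
    simp [hH]; ring
  have hev : ∀ᶠ n in atTop, H (n + 1) = H n := by
    filter_upwards [hHd.norm.eventually_lt_const (u := 1) (by simp)] with n hn
    obtain ⟨k, hk⟩ := Complex.exp_eq_exp_iff_exists_int.mp ((hexp (n + 1)).trans (hexp n).symm)
    rw [hk, add_sub_cancel_left] at hn
    have hk0 : k = 0 := by
      by_contra hk0
      have h1 : (1 : ℝ) ≤ |(k : ℝ)| := by exact_mod_cast Int.one_le_abs hk0
      have : ‖(k : ℂ) * (2 * Real.pi * Complex.I)‖ = |(k : ℝ)| * (2 * Real.pi) := by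
        simp [abs_of_pos Real.pi_pos]
      rw [this] at hn
      nlinarith [Real.pi_gt_three]
    rw [hk, hk0]; simp
  obtain ⟨N, hN⟩ := eventually_atTop.mp hev
  have hconst : ∀ n ≥ N, H n = H N := fun n hn ↦
    Nat.le_induction rfl (fun m hm ih ↦ (hN m hm).trans ih) n hn
  have hlim : Tendsto S atTop (𝓝 (H N)) := by
    have : Tendsto (fun n ↦ H N + Complex.log (Complex.exp (S n) / c)) atTop (𝓝 (H N + 0)) :=
      tendsto_const_nhds.add hlog
    rw [add_zero] at this
    refine this.congr' ?_
    filter_upwards [eventually_ge_atTop N] with n hn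
    rw [← hconst n hn]; simp [hH]
  obtain ⟨B, hB⟩ := hlim.norm.bddAbove_range
  exact ⟨B, fun n ↦ hB ⟨n, rfl⟩⟩

/-- A continuous logarithm of a function with nonzero limit at `0⁺` is bounded near `0⁺`. -/
lemma exists_eventually_norm_le_of_tendsto_exp {G : ℝ → ℂ} {c : ℂ} (hc : c ≠ 0)
    (hcont : ContinuousOn G (Set.Ioi 0))
    (hG : Tendsto (fun t ↦ Complex.exp (G t)) (𝓝[>] 0) (𝓝 c)) :
    ∃ B : ℝ, ∀ᶠ t in 𝓝[>] 0, ‖G t‖ ≤ B := by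
  have hP : Tendsto (fun t ↦ Complex.exp (G t) / c) (𝓝[>] 0) (𝓝 1) := by
    simpa [hc] using hG.div_const c
  have hlog : Tendsto (fun t ↦ Complex.log (Complex.exp (G t) / c)) (𝓝[>] 0) (𝓝 0) := by
    simpa using hP.clog (by simp)
  have hslit : ∀ᶠ t in 𝓝[>] (0 : ℝ), Complex.exp (G t) / c ∈ Complex.slitPlane :=
    hP.eventually (Complex.isOpen_slitPlane.mem_nhds (by simp))
  obtain ⟨ε, hε, hsub⟩ := mem_nhdsGT_iff_exists_Ioo_subset.mp hslit
  have hε : 0 < ε := hε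
  set H : ℝ → ℂ := fun t ↦ G t - Complex.log (Complex.exp (G t) / c) with hH
  have hexp (t) : Complex.exp (H t) = c := by
    have : Complex.exp (G t) / c ≠ 0 := div_ne_zero (Complex.exp_ne_zero _) hc
    rw [hH, Complex.exp_sub, Complex.exp_log this]
    field_simp [Complex.exp_ne_zero (G t)]
  have hGc : ContinuousOn G (Set.Ioo 0 ε) := hcont.mono fun t ht ↦ ht.1
  have hHc : ContinuousOn H (Set.Ioo 0 ε) :=
    hGc.sub (ContinuousOn.clog ((Complex.continuous_exp.comp_continuousOn hGc).div_const c)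
      fun t ht ↦ hsub ht)
  -- `H` is continuous on an interval, with values in the discrete fibre of `exp` over `c`.
  have hconst : ∀ t ∈ Set.Ioo 0 ε, H t = H (ε / 2) := by
    intro t ht
    have hmid : ε / 2 ∈ Set.Ioo 0 ε := ⟨by linarith, by linarith⟩
    have hk (u : ℝ) : ∃ k : ℤ, H u = H (ε / 2) + k * (2 * Real.pi * Complex.I) :=
      Complex.exp_eq_exp_iff_exists_int.mp ((hexp u).trans (hexp _).symm)
    choose k hk using hk
    have hkim (u : ℝ) : ((k u : ℤ) : ℝ) = ((H u).im - (H (ε / 2)).im) / (2 * Real.pi) := by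
      rw [hk u]
      simp
    have hkc : ContinuousOn (fun u ↦ ((k u : ℤ) : ℝ)) (Set.Ioo 0 ε) := by
      simp_rw [hkim]
      exact ((Complex.continuous_im.comp_continuousOn hHc).sub continuousOn_const).div_const _
    have hkc' : ContinuousOn k (Set.Ioo 0 ε) :=
      Int.isClosedEmbedding_coe_real.isInducing.continuousOn_iff.mpr hkc
    have hkk : k t = k (ε / 2) := isPreconnected_Ioo.constant hkc' ht hmid
    rw [hk t, hkk, ← hk]
  refine ⟨‖H (ε / 2)‖ + 1, ?_⟩
  filter_upwards [Ioo_mem_nhdsGT hε, hlog.norm.eventually_lt_const (u := 1) (by simp)] with t ht h1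
  have : G t = H (ε / 2) + Complex.log (Complex.exp (G t) / c) := by
    rw [← hconst t ht]; simp [hH]
  rw [this]
  exact (norm_add_le _ _).trans (by linarith)

/-! ### Sums over primes near `s = 1` -/

/-- `∑ Λ(n) n^(-1-t) = O(1/t)`. The source is Mathlib's continuity on `re s ≥ 1` of the von Mangoldt
series of a residue class with the pole at `1` removed, for the modulus `1`. -/
lemma exists_tsum_vonMangoldt_le : ∃ C : ℝ, ∀ t : ℝ, 0 < t → t ≤ 1 →
    Summable (fun n : ℕ ↦ ArithmeticFunction.vonMangoldt n * (n : ℝ) ^ (-1 - t)) ∧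
    ∑' n : ℕ, ArithmeticFunction.vonMangoldt n * (n : ℝ) ^ (-1 - t) ≤ C / t := by
  have hres (n : ℕ) : ArithmeticFunction.vonMangoldt.residueClass (1 : ZMod 1) n =
      ArithmeticFunction.vonMangoldt n := by
    simp [ArithmeticFunction.vonMangoldt.residueClass, Subsingleton.elim _ (1 : ZMod 1)]
  have hc : ContinuousOn (fun x : ℝ ↦
      ArithmeticFunction.vonMangoldt.LFunctionResidueClassAux (1 : ZMod 1) x) (Set.Icc 1 2) :=
    (ArithmeticFunction.vonMangoldt.continuousOn_LFunctionResidueClassAux (1 : ZMod 1)).comp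
      Complex.continuous_ofReal.continuousOn fun x hx ↦ by simpa using hx.1
  obtain ⟨C, hC⟩ := isCompact_Icc.exists_bound_of_continuousOn hc
  refine ⟨C + 1, fun t ht ht1 ↦ ?_⟩
  have hs : 1 < ((1 + t : ℝ) : ℂ).re := by simpa using ht
  have hterm (n : ℕ) : LSeries.term (fun n ↦ (ArithmeticFunction.vonMangoldt n : ℂ))
      ((1 + t : ℝ) : ℂ) n = ((ArithmeticFunction.vonMangoldt n * (n : ℝ) ^ (-1 - t) : ℝ) : ℂ) := by
    rcases eq_or_ne n 0 with rfl | hn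
    · simp
    · rw [LSeries.term_of_ne_zero hn, show -1 - t = -(1 + t) by ring,
        Real.rpow_neg n.cast_nonneg, Complex.ofReal_mul, Complex.ofReal_inv,
        Complex.ofReal_cpow n.cast_nonneg, Complex.ofReal_natCast, div_eq_mul_inv]
  have hsum : Summable (fun n : ℕ ↦ ArithmeticFunction.vonMangoldt n * (n : ℝ) ^ (-1 - t)) := by
    exact Complex.summable_ofReal.mp
      ((summable_congr hterm).mp (ArithmeticFunction.LSeriesSummable_vonMangoldt hs))
  refine ⟨hsum, ?_⟩
  have heq := ArithmeticFunction.vonMangoldt.eqOn_LFunctionResidueClassAux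
    (a := (1 : ZMod 1)) isUnit_one hs
  have hL : LSeries (fun n ↦ (ArithmeticFunction.vonMangoldt n : ℂ)) ((1 + t : ℝ) : ℂ) =
      ((∑' n : ℕ, ArithmeticFunction.vonMangoldt n * (n : ℝ) ^ (-1 - t) : ℝ) : ℂ) := by
    rw [LSeries, Complex.ofReal_tsum]
    exact tsum_congr hterm
  simp only [hres, hL, Nat.totient_one] at heq
  have hb := hC (1 + t) ⟨by linarith, by linarith⟩
  rw [heq] at hb
  have hre := (Complex.re_le_norm _).trans hb
  have : ((((∑' n : ℕ, ArithmeticFunction.vonMangoldt n * (n : ℝ) ^ (-1 - t) : ℝ) : ℂ) -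
      ((1 : ℕ) : ℂ)⁻¹ / (((1 + t : ℝ) : ℂ) - 1))) =
      ((∑' n : ℕ, ArithmeticFunction.vonMangoldt n * (n : ℝ) ^ (-1 - t) - 1 / t : ℝ) : ℂ) := by
    push_cast; simp
  rw [this, Complex.ofReal_re] at hre
  have hC0 : 0 ≤ C := (norm_nonneg _).trans hb
  have h2 : C ≤ C / t := by rw [le_div_iff₀ ht]; nlinarith
  rw [add_div]
  linarith

lemma exists_tsum_log_mul_rpow_le : ∃ C : ℝ, ∀ t : ℝ, 0 < t → t ≤ 1 →
    Summable (fun p : Nat.Primes ↦ Real.log p * (p : ℝ) ^ (-1 - t)) ∧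
    ∑' p : Nat.Primes, Real.log p * (p : ℝ) ^ (-1 - t) ≤ C / t := by
  obtain ⟨C, hC⟩ := exists_tsum_vonMangoldt_le
  refine ⟨C, fun t ht ht1 ↦ ?_⟩
  obtain ⟨hs, hle⟩ := hC t ht ht1
  have hinj : Function.Injective (fun p : Nat.Primes ↦ (p : ℕ)) := Nat.Primes.coe_nat_injective
  have hfun : (fun p : Nat.Primes ↦ Real.log p * (p : ℝ) ^ (-1 - t)) =
      (fun n : ℕ ↦ ArithmeticFunction.vonMangoldt n * (n : ℝ) ^ (-1 - t)) ∘
        (fun p : Nat.Primes ↦ (p : ℕ)) := by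
    ext p
    simp [ArithmeticFunction.vonMangoldt_apply_prime p.2]
  rw [hfun]
  refine ⟨hs.comp_injective hinj, le_trans ?_ hle⟩
  exact tsum_comp_le_tsum_of_inj hs
    (fun n ↦ mul_nonneg ArithmeticFunction.vonMangoldt_nonneg (by positivity)) hinj

/-- The cut-off weight `1/p` for `p ≤ x` compared with the smooth weight `p^(-1-1/log x)`. With
`u = log p / log x` the ratio of the two is `exp u` for `u ≤ 1`, and `0` for `u > 1`. -/
lemma abs_rpow_sub_indicator_le {x : ℝ} (hx : 3 ≤ x) {p : ℕ} (hp : p.Prime) :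
    |(p : ℝ) ^ (-1 - 1 / Real.log x) - if p ≤ ⌊x⌋₊ then (p : ℝ)⁻¹ else 0| ≤
      3 * (1 / Real.log x) * (Real.log p * (p : ℝ) ^ (-1 - 1 / Real.log x)) := by
  have hlx : 0 < Real.log x := Real.log_pos (by linarith)
  have hp0 : (0 : ℝ) < p := by exact_mod_cast hp.pos
  have hp1 : (1 : ℝ) < p := by exact_mod_cast hp.one_lt
  have hlp : 0 < Real.log p := Real.log_pos hp1
  set q := (p : ℝ) ^ (-1 - 1 / Real.log x) with hq
  have hq0 : 0 < q := Real.rpow_pos_of_pos hp0 _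
  set u := Real.log p / Real.log x with hu
  have hu0 : 0 < u := div_pos hlp hlx
  have hrw : 3 * (1 / Real.log x) * (Real.log p * q) = 3 * u * q := by rw [hu]; ring
  rw [hrw]
  split_ifs with h
  · have hpx : (p : ℝ) ≤ x := (Nat.le_floor_iff (by linarith)).mp h
    have hu1 : u ≤ 1 := by
      rw [hu, div_le_one hlx]; exact Real.log_le_log hp0 hpx
    have hinv : (p : ℝ)⁻¹ = q * Real.exp u := by
      rw [hq, Real.rpow_def_of_pos hp0, ← Real.exp_add, ← Real.exp_log hp0, ← Real.exp_neg,
        Real.log_exp]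
      congr 1
      rw [hu]; ring
    have hexp : Real.exp u - 1 ≤ 2 * u := by
      have := Real.abs_exp_sub_one_le (x := u) (by rwa [abs_of_pos hu0])
      rw [abs_of_pos hu0] at this
      exact (le_abs_self _).trans this
    have hexp0 : 1 ≤ Real.exp u := Real.one_le_exp hu0.le
    rw [hinv, show q - q * Real.exp u = -(q * (Real.exp u - 1)) by ring, abs_neg,
      abs_of_nonneg (mul_nonneg hq0.le (by linarith))]
    nlinarith
  · have hpx : x < p := by
      by_contra hcon
      exact h (Nat.le_floor (not_lt.mp hcon))
    have hu1 : 1 ≤ u := by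
      rw [hu, one_le_div hlx]; exact Real.log_le_log (by linarith) hpx.le
    rw [sub_zero, abs_of_pos hq0]
    nlinarith

lemma summable_primes_rpow {t : ℝ} (ht : 0 < t) :
    Summable (fun p : Nat.Primes ↦ (p : ℝ) ^ (-1 - t)) :=
  Nat.Primes.summable_rpow.mpr (by linarith)

lemma sum_primesBelow_eq_tsum (f : ℕ → ℂ) (n : ℕ) :
    ∑ p ∈ Nat.primesBelow (n + 1), f p = ∑' p : Nat.Primes, if (p : ℕ) ≤ n then f p else 0 := by
  let s : Finset Nat.Primes := (Nat.primesBelow (n + 1)).subtype Nat.Prime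
  have hs (p : Nat.Primes) : p ∈ s ↔ (p : ℕ) ≤ n := by
    refine Finset.mem_subtype.trans ?_
    rw [Nat.mem_primesBelow, Nat.lt_succ_iff]
    exact and_iff_left p.2
  rw [tsum_eq_sum (s := s) fun p hp ↦ if_neg (mt (hs p).mpr hp)]
  rw [Finset.sum_congr rfl fun p hp ↦ if_pos ((hs p).mp hp)]
  exact (Finset.sum_subtype_of_mem f fun p hp ↦ Nat.prime_of_mem_primesBelow hp).symm

/-- For bounded coefficients, the sum of `a p / p` over `p ≤ x` is within `O(1)` of the Dirichlet
series at `1 + 1 / log x`. -/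
lemma exists_norm_tsum_sub_sum_le {a : ℕ → ℂ} {R : ℝ} (ha : ∀ p, p.Prime → ‖a p‖ ≤ R) :
    ∃ B : ℝ, ∀ x : ℝ, 3 ≤ x →
      ‖∑' p : Nat.Primes, a p * ((p : ℝ) ^ (-1 - 1 / Real.log x) : ℝ) -
        ∑ p ∈ Nat.primesBelow (⌊x⌋₊ + 1), a p * ((p : ℝ)⁻¹ : ℝ)‖ ≤ B := by
  obtain ⟨C, hC⟩ := exists_tsum_log_mul_rpow_le
  refine ⟨R * (3 * C), fun x hx ↦ ?_⟩
  have hlx : 1 ≤ Real.log x := by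
    rw [Real.le_log_iff_exp_le (by linarith)]
    linarith [Real.exp_one_lt_d9]
  have hR : 0 ≤ R := (norm_nonneg _).trans (ha 2 Nat.prime_two)
  set t := 1 / Real.log x with ht
  have ht0 : 0 < t := by positivity
  have ht1 : t ≤ 1 := by rw [ht, div_le_one (by linarith)]; exact hlx
  obtain ⟨hs, hle⟩ := hC t ht0 ht1
  have hs1 : Summable fun p : Nat.Primes ↦ a p * ((p : ℝ) ^ (-1 - t) : ℝ) := by
    refine ((summable_primes_rpow ht0).mul_left R).of_norm_bounded fun p ↦ ?_
    rw [norm_mul, Complex.norm_real, Real.norm_of_nonneg (by positivity)]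
    exact mul_le_mul_of_nonneg_right (ha p p.2) (by positivity)
  have hs2 : Summable fun p : Nat.Primes ↦
      if (p : ℕ) ≤ ⌊x⌋₊ then a p * ((p : ℝ)⁻¹ : ℝ) else 0 := by
    refine summable_of_hasFiniteSupport ((Set.finite_le_nat ⌊x⌋₊).preimage
      (Nat.Primes.coe_nat_injective.injOn) |>.subset fun p hp ↦ ?_)
    by_contra hcon
    exact hp (if_neg hcon)
  rw [sum_primesBelow_eq_tsum, ← hs1.tsum_sub hs2]
  have hbound := hs.mul_left (R * (3 * t))
  refine (tsum_of_norm_bounded hbound.hasSum fun p ↦ ?_).trans ?_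
  · have := abs_rpow_sub_indicator_le hx p.2
    rw [← ht] at this
    have hfac : (a p * ((p : ℝ) ^ (-1 - t) : ℝ) -
        if (p : ℕ) ≤ ⌊x⌋₊ then a p * ((p : ℝ)⁻¹ : ℝ) else 0 : ℂ) = a p * (((p : ℝ) ^ (-1 - t) -
          if (p : ℕ) ≤ ⌊x⌋₊ then (p : ℝ)⁻¹ else 0 : ℝ) : ℂ) := by
      split_ifs <;> push_cast <;> ring
    rw [hfac, norm_mul, Complex.norm_real, Real.norm_eq_abs, mul_assoc R]
    exact mul_le_mul (ha p p.2) this (abs_nonneg _) hR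
  · rw [tsum_mul_left]
    calc R * (3 * t) * ∑' p : Nat.Primes, Real.log p * (p : ℝ) ^ (-1 - t)
        ≤ R * (3 * t) * (C / t) := mul_le_mul_of_nonneg_left hle (by positivity)
      _ = R * (3 * C) := by field_simp

/-! ### Logarithms of Euler factors -/

lemma norm_log_one_sub_inv_sub_self_le_two_mul {w : ℂ} (hw : ‖w‖ ≤ 3 / 4) :
    ‖Complex.log (1 - w)⁻¹ - w‖ ≤ 2 * ‖w‖ ^ 2 := by
  refine (Complex.norm_log_one_sub_inv_sub_self_le (by linarith)).trans ?_
  have : (1 - ‖w‖)⁻¹ ≤ 4 := by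
    rw [inv_le_comm₀ (by linarith) (by norm_num)]; linarith
  nlinarith [sq_nonneg ‖w‖, mul_le_mul_of_nonneg_left this (sq_nonneg ‖w‖)]

lemma norm_log_one_sub_inv_sub_sub_le {w : ℂ} (hw : ‖w‖ ≤ 3 / 4) :
    ‖Complex.log (1 - w)⁻¹ - w - w ^ 2 / 2‖ ≤ 2 * ‖w‖ ^ 3 := by
  have h := Complex.norm_log_one_sub_inv_add_logTaylor_neg_le 2 (z := w) (by linarith)
  have e : Complex.log (1 - w)⁻¹ - w - w ^ 2 / 2 =
      Complex.log (1 - w)⁻¹ + Complex.logTaylor (2 + 1) (-w) := by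
    simp [Complex.logTaylor_succ, Complex.logTaylor_zero]
    ring
  rw [e]
  refine h.trans ?_
  have : (1 - ‖w‖)⁻¹ ≤ 4 := by
    rw [inv_le_comm₀ (by linarith) (by norm_num)]; linarith
  have h3 : 0 ≤ ‖w‖ ^ 3 := by positivity
  norm_num
  nlinarith [mul_le_mul_of_nonneg_left this h3]

variable {r : ℕ}

/-- The logarithm of an Euler factor: `e p` lists the eigenvalues of the matrix at `p` with
multiplicity, and the principal logarithms are taken eigenvalue by eigenvalue. This is in general
not the principal logarithm of the Euler factor, but it is small when `p ^ (-s)` is. -/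
noncomputable def logEulerFactor (e : ℕ → Fin r → ℂ) (s : ℂ) (p : ℕ) : ℂ :=
  ∑ i, Complex.log (1 - (p : ℂ) ^ (-s) * e p i)⁻¹

lemma prime_rpow_neg_le {p : ℕ} (hp : p.Prime) {σ : ℝ} (hσ : 1 / 2 ≤ σ) :
    (p : ℝ) ^ (-σ) ≤ 3 / 4 := by
  have hp2 : (2 : ℝ) ≤ p := by exact_mod_cast hp.two_le
  have h1 : (p : ℝ) ^ (-σ) ≤ (p : ℝ) ^ (-(1 / 2) : ℝ) :=
    Real.rpow_le_rpow_of_exponent_le (by linarith) (by linarith)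
  refine h1.trans ?_
  rw [Real.rpow_neg (by linarith), ← Real.sqrt_eq_rpow, inv_le_comm₀ (by positivity) (by norm_num)]
  exact Real.le_sqrt_of_sq_le (by norm_num; linarith)

section

variable {e : ℕ → Fin r → ℂ} {s : ℂ} {p : ℕ}

lemma norm_cpow_neg_mul_le (he : ∀ i, ‖e p i‖ ≤ 1) (hp : p.Prime) (i : Fin r) :
    ‖(p : ℂ) ^ (-s) * e p i‖ ≤ (p : ℝ) ^ (-s.re) := by
  rw [norm_mul, Complex.norm_natCast_cpow_of_pos hp.pos, Complex.neg_re]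
  exact mul_le_of_le_one_right (by positivity) (he i)

lemma one_sub_cpow_neg_mul_mem_slitPlane (he : ∀ i, ‖e p i‖ ≤ 1) (hp : p.Prime)
    (hs : 1 / 2 ≤ s.re) (i : Fin r) : 1 - (p : ℂ) ^ (-s) * e p i ∈ Complex.slitPlane := by
  rw [sub_eq_add_neg]
  apply Complex.mem_slitPlane_of_norm_lt_one
  rw [norm_neg]
  linarith [norm_cpow_neg_mul_le (s := s) he hp i, prime_rpow_neg_le hp hs]

lemma exp_logEulerFactor {A : ℕ → Matrix (Fin r) (Fin r) ℂ} (he : ∀ i, ‖e p i‖ ≤ 1)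
    (hdet : ∀ z : ℂ, (1 - z • A p).det = ∏ i, (1 - z * e p i)) (hp : p.Prime)
    (hs : 1 / 2 ≤ s.re) : Complex.exp (logEulerFactor e s p) = eulerFactor A s p := by
  rw [logEulerFactor, Complex.exp_sum, eulerFactor, hdet, ← Finset.prod_inv_distrib]
  refine Finset.prod_congr rfl fun i _ ↦ Complex.exp_log (inv_ne_zero ?_)
  exact Complex.slitPlane_ne_zero (one_sub_cpow_neg_mul_mem_slitPlane he hp hs i)

lemma norm_logEulerFactor_sub_le (he : ∀ i, ‖e p i‖ ≤ 1) (hp : p.Prime) (hs : 1 / 2 ≤ s.re) :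
    ‖logEulerFactor e s p - (p : ℂ) ^ (-s) * ∑ i, e p i‖ ≤ 2 * r * ((p : ℝ) ^ (-s.re)) ^ 2 := by
  rw [logEulerFactor, Finset.mul_sum, ← Finset.sum_sub_distrib]
  have hsum : ∑ _i : Fin r, 2 * ((p : ℝ) ^ (-s.re)) ^ 2 = 2 * r * ((p : ℝ) ^ (-s.re)) ^ 2 := by
    rw [Finset.sum_const, Finset.card_univ, Fintype.card_fin, nsmul_eq_mul]
    ring
  rw [← hsum]
  refine norm_sum_le_of_le Finset.univ fun i _ ↦ ?_
  have h := norm_cpow_neg_mul_le (s := s) he hp i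
  refine (norm_log_one_sub_inv_sub_self_le_two_mul (h.trans (prime_rpow_neg_le hp hs))).trans ?_
  gcongr

lemma norm_logEulerFactor_sub_sub_le (he : ∀ i, ‖e p i‖ ≤ 1) (hp : p.Prime)
    (hs : 1 / 2 ≤ s.re) :
    ‖logEulerFactor e s p - (p : ℂ) ^ (-s) * ∑ i, e p i -
      ((p : ℂ) ^ (-s)) ^ 2 * ∑ i, e p i ^ 2 / 2‖ ≤ 2 * r * ((p : ℝ) ^ (-s.re)) ^ 3 := by
  rw [logEulerFactor, Finset.mul_sum, Finset.mul_sum, ← Finset.sum_sub_distrib,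
    ← Finset.sum_sub_distrib]
  have hsum : ∑ _i : Fin r, 2 * ((p : ℝ) ^ (-s.re)) ^ 3 = 2 * r * ((p : ℝ) ^ (-s.re)) ^ 3 := by
    rw [Finset.sum_const, Finset.card_univ, Fintype.card_fin, nsmul_eq_mul]
    ring
  rw [← hsum]
  refine norm_sum_le_of_le Finset.univ fun i _ ↦ ?_
  have h := norm_cpow_neg_mul_le (s := s) he hp i
  rw [← mul_div_assoc, ← mul_pow]
  refine (norm_log_one_sub_inv_sub_sub_le (h.trans (prime_rpow_neg_le hp hs))).trans ?_
  gcongr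

lemma norm_logEulerFactor_le (he : ∀ i, ‖e p i‖ ≤ 1) (hp : p.Prime) (hs : 1 / 2 ≤ s.re) :
    ‖logEulerFactor e s p‖ ≤ 3 * r * (p : ℝ) ^ (-s.re) := by
  have h1 := norm_logEulerFactor_sub_le he hp hs
  have h2 : ‖(p : ℂ) ^ (-s) * ∑ i, e p i‖ ≤ r * (p : ℝ) ^ (-s.re) := by
    rw [Finset.mul_sum]
    exact (norm_sum_le_of_le _ fun i _ ↦ norm_cpow_neg_mul_le he hp i).trans (by simp)
  have h3 := prime_rpow_neg_le hp hs
  have h4 : 0 ≤ (p : ℝ) ^ (-s.re) := by positivity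
  have h5 : ((p : ℝ) ^ (-s.re)) ^ 2 ≤ (p : ℝ) ^ (-s.re) := by nlinarith
  have h6 := norm_add_le (logEulerFactor e s p - (p : ℂ) ^ (-s) * ∑ i, e p i)
    ((p : ℂ) ^ (-s) * ∑ i, e p i)
  rw [sub_add_cancel] at h6
  nlinarith [mul_le_mul_of_nonneg_left h5 (Nat.cast_nonneg (α := ℝ) r)]

lemma continuousAt_logEulerFactor (he : ∀ i, ‖e p i‖ ≤ 1) (hp : p.Prime) (hs : 1 / 2 ≤ s.re) :
    ContinuousAt (fun s ↦ logEulerFactor e s p) s := by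
  refine tendsto_finsetSum _ fun i _ ↦ ?_
  have hsl := one_sub_cpow_neg_mul_mem_slitPlane he hp hs i
  have hp0 : (p : ℂ) ≠ 0 := by exact_mod_cast hp.ne_zero
  have hcp : ContinuousAt (fun s : ℂ ↦ (p : ℂ) ^ (-s)) s :=
    continuousAt_id.neg.const_cpow (.inl hp0)
  refine ContinuousAt.clog ((continuousAt_const.sub (hcp.mul continuousAt_const)).inv₀
    (Complex.slitPlane_ne_zero hsl)) ?_
  rw [Complex.mem_slitPlane_iff_arg] at hsl ⊢
  rw [Complex.arg_inv, if_neg hsl.1]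
  refine ⟨fun h ↦ ?_, inv_ne_zero hsl.2⟩
  linarith [Complex.neg_pi_lt_arg (1 - (p : ℂ) ^ (-s) * e p i)]

end

section

variable {e : ℕ → Fin r → ℂ} (he : ∀ p, p.Prime → ∀ i, ‖e p i‖ ≤ 1)

include he

lemma norm_logEulerFactor_one_add_le {t u : ℝ} (ht : 0 < t) (htu : t ≤ u) (p : Nat.Primes) :
    ‖logEulerFactor e (1 + u : ℝ) p‖ ≤ 3 * r * (p : ℝ) ^ (-1 - t) := by
  refine (norm_logEulerFactor_le (he p p.2) p.2 (by simp; linarith)).trans ?_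
  gcongr
  · exact_mod_cast p.2.one_le
  · simp; linarith

lemma summable_logEulerFactor {t : ℝ} (ht : 0 < t) :
    Summable fun p : Nat.Primes ↦ logEulerFactor e (1 + t : ℝ) p :=
  ((summable_primes_rpow ht).mul_left (3 * (r : ℝ))).of_norm_bounded
    (norm_logEulerFactor_one_add_le he ht le_rfl)

lemma exp_tsum_logEulerFactor {A : ℕ → Matrix (Fin r) (Fin r) ℂ}
    (hdet : ∀ p, p.Prime → ∀ z : ℂ, (1 - z • A p).det = ∏ i, (1 - z * e p i))
    {t : ℝ} (ht : 0 < t) :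
    Complex.exp (∑' p : Nat.Primes, logEulerFactor e (1 + t : ℝ) p) =
      eulerProduct A (1 + t : ℝ) := by
  have h := (summable_logEulerFactor he ht).hasSum.cexp
  have hfun : (Complex.exp ∘ fun p : Nat.Primes ↦ logEulerFactor e (1 + t : ℝ) p) =
      fun p : Nat.Primes ↦ eulerFactor A (1 + t : ℝ) p := by
    ext p
    exact exp_logEulerFactor (he p p.2) (hdet p p.2) p.2 (by simp; linarith)
  rw [hfun] at h
  exact h.tprod_eq.symm

lemma continuousOn_tsum_logEulerFactor :
    ContinuousOn (fun t : ℝ ↦ ∑' p : Nat.Primes, logEulerFactor e (1 + t : ℝ) p) (Set.Ioi 0) := by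
  intro t ht
  have ht : 0 < t := ht
  have hc : ContinuousOn (fun t : ℝ ↦ ∑' p : Nat.Primes, logEulerFactor e (1 + t : ℝ) p)
      (Set.Ici (t / 2)) := by
    refine continuousOn_tsum (u := fun p : Nat.Primes ↦ 3 * r * (p : ℝ) ^ (-1 - t / 2))
      (fun p u hu ↦ ?_) ((summable_primes_rpow (half_pos ht)).mul_left _)
      fun p u hu ↦ norm_logEulerFactor_one_add_le he (half_pos ht) hu p
    have hu : t / 2 ≤ u := hu
    refine ContinuousAt.continuousWithinAt ?_
    refine ContinuousAt.comp (f := fun u : ℝ ↦ ((1 + u : ℝ) : ℂ))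
      (continuousAt_logEulerFactor (he p p.2) p.2 ?_) (by fun_prop)
    simp; linarith
  exact (hc.continuousAt (Ici_mem_nhds (by linarith))).continuousWithinAt

lemma exists_norm_tsum_logEulerFactor_sub_le :
    ∃ B : ℝ, ∀ t : ℝ, 0 < t →
      ‖∑' p : Nat.Primes, logEulerFactor e (1 + t : ℝ) p -
        ∑' p : Nat.Primes, (∑ i, e p i) * ((p : ℝ) ^ (-1 - t) : ℝ)‖ ≤ B := by
  refine ⟨∑' p : Nat.Primes, 2 * r * (p : ℝ) ^ (-1 - 1 : ℝ), fun t ht ↦ ?_⟩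
  have hcast (p : Nat.Primes) : (p : ℂ) ^ (-((1 + t : ℝ) : ℂ)) * ∑ i, e p i =
      (∑ i, e p i) * ((p : ℝ) ^ (-1 - t) : ℝ) := by
    rw [mul_comm, Complex.ofReal_cpow (Nat.cast_nonneg _)]
    congr 2
    push_cast; ring
  have hb (p : Nat.Primes) : ‖logEulerFactor e (1 + t : ℝ) p -
      (∑ i, e p i) * ((p : ℝ) ^ (-1 - t) : ℝ)‖ ≤ 2 * r * (p : ℝ) ^ (-1 - 1 : ℝ) := by
    have h := norm_logEulerFactor_sub_le (s := ((1 + t : ℝ) : ℂ)) (he p p.2) p.2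
      (by simp; linarith)
    rw [hcast] at h
    refine h.trans ?_
    gcongr
    rw [← Real.rpow_natCast, ← Real.rpow_mul (Nat.cast_nonneg _)]
    refine Real.rpow_le_rpow_of_exponent_le (by exact_mod_cast p.2.one_le) ?_
    simp; linarith
  have hs := ((summable_primes_rpow one_pos).mul_left (2 * (r : ℝ)))
  have hs1 := summable_logEulerFactor he ht
  have hs2 := hs1.sub (hs.of_norm_bounded hb)
  simp only [sub_sub_cancel] at hs2
  rw [← hs1.tsum_sub hs2]
  exact tsum_of_norm_bounded hs.hasSum hb

end

/-! ### The sum of `tr A(p) / p` -/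

lemma tendsto_one_add_nhdsGT : Tendsto (fun t : ℝ ↦ ((1 + t : ℝ) : ℂ)) (𝓝[>] 0) (𝓝[≠] 1) := by
  refine tendsto_nhdsWithin_iff.mpr ⟨?_, ?_⟩
  · have : Continuous fun t : ℝ ↦ ((1 + t : ℝ) : ℂ) := by fun_prop
    simpa using (this.tendsto 0).mono_left nhdsWithin_le_nhds
  · filter_upwards [self_mem_nhdsWithin] with t ht
    have ht : 0 < t := ht
    simpa using ht.ne'

/-- A form of Mertens' second theorem: the pole order at `1` of the continued Euler product governs
the sum of `tr A(p) / p` up to a bounded error. -/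
theorem exists_norm_sum_trace_div_sub_le {A : ℕ → Matrix (Fin r) (Fin r) ℂ}
    (hA : ∀ p, p.Prime → A p ∈ Matrix.unitaryGroup (Fin r) ℂ ∨ A p = 0) {L : ℂ → ℂ}
    (hL : IsMeromorphicContinuationAtOne A L) :
    ∃ B : ℝ, ∀ᶠ x : ℝ in atTop,
      ‖∑ p ∈ Nat.primesBelow (⌊x⌋₊ + 1), (A p).trace * ((p : ℝ)⁻¹ : ℝ) -
        poleOrderAt L 1 * (Real.log (Real.log x) : ℝ)‖ ≤ B := by
  have hex (p : ℕ) : ∃ e : Fin r → ℂ, p.Prime → (∀ i, ‖e i‖ ≤ 1) ∧ (A p).trace = ∑ i, e i ∧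
      ∀ z : ℂ, (1 - z • A p).det = ∏ i, (1 - z * e i) := by
    by_cases hp : p.Prime
    · obtain ⟨e, h1, h2, -, h3⟩ := exists_eigenvalues (hA p hp)
      exact ⟨e, fun _ ↦ ⟨h1, h2, h3⟩⟩
    · exact ⟨0, fun h ↦ absurd h hp⟩
  choose e he' using hex
  have he (p : ℕ) (hp : p.Prime) := (he' p hp).1
  have htr (p : ℕ) (hp : p.Prime) := (he' p hp).2.1
  have hdet (p : ℕ) (hp : p.Prime) := (he' p hp).2.2
  set F : ℝ → ℂ := fun t ↦ ∑' p : Nat.Primes, logEulerFactor e (1 + t : ℝ) p with hF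
  have hLF (t : ℝ) (ht : 0 < t) : L (1 + t : ℝ) = Complex.exp (F t) := by
    rw [hL.eq_eulerProduct _ (by simpa using ht), hF, exp_tsum_logEulerFactor he hdet ht]
  -- The Euler product has no zeros to the right of `1`, so `poleOrderAt` is not a default value.
  have htop : meromorphicOrderAt L 1 ≠ ⊤ := by
    intro htop
    have h0 := tendsto_one_add_nhdsGT.eventually (meromorphicOrderAt_eq_top_iff.mp htop)
    obtain ⟨t, ht, ht0⟩ := (h0.and self_mem_nhdsWithin).exists
    rw [hLF t ht0] at ht
    exact Complex.exp_ne_zero _ ht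
  obtain ⟨g, hg, hg1, hLg⟩ := (meromorphicOrderAt_ne_top_iff hL.meromorphicAt).mp htop
  set n : ℤ := (meromorphicOrderAt L 1).untop₀ with hn
  have hexp : Tendsto (fun t ↦ Complex.exp (F t - n * (Real.log t : ℝ))) (𝓝[>] 0) (𝓝 (g 1)) := by
    refine (hg.continuousAt.tendsto.comp
      (tendsto_one_add_nhdsGT.mono_right nhdsWithin_le_nhds)).congr' ?_
    filter_upwards [tendsto_one_add_nhdsGT.eventually hLg, self_mem_nhdsWithin] with t ht ht0
    have ht0 : 0 < t := ht0
    have ht0' : (t : ℂ) ≠ 0 := by exact_mod_cast ht0.ne'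
    rw [Complex.exp_sub, ← hLF t ht0, ht, Complex.exp_int_mul, ← Complex.ofReal_exp,
      Real.exp_log ht0]
    simp only [Function.comp, Complex.ofReal_add, Complex.ofReal_one, add_sub_cancel_left,
      smul_eq_mul]
    rw [mul_div_cancel_left₀ _ (zpow_ne_zero n ht0')]
  have hcont : ContinuousOn (fun t : ℝ ↦ F t - n * (Real.log t : ℝ)) (Set.Ioi 0) := by
    refine (continuousOn_tsum_logEulerFactor he).sub (continuousOn_const.mul ?_)
    exact Complex.continuous_ofReal.comp_continuousOn
      (Real.continuousOn_log.mono fun t ht ↦ (ne_of_gt ht))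
  obtain ⟨B₁, hB₁⟩ := exists_eventually_norm_le_of_tendsto_exp hg1 hcont hexp
  obtain ⟨B₂, hB₂⟩ := exists_norm_tsum_logEulerFactor_sub_le he
  obtain ⟨B₃, hB₃⟩ := exists_norm_tsum_sub_sum_le (a := fun p ↦ ∑ i, e p i) (R := r) fun p hp ↦ by
    simpa using norm_sum_le_of_le Finset.univ fun i _ ↦ he p hp i
  refine ⟨B₁ + B₂ + B₃, ?_⟩
  have ht : Tendsto (fun x : ℝ ↦ 1 / Real.log x) atTop (𝓝[>] 0) := by
    simp_rw [one_div]
    exact tendsto_inv_atTop_nhdsGT_zero.comp Real.tendsto_log_atTop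
  filter_upwards [ht.eventually hB₁, ht.eventually self_mem_nhdsWithin, eventually_ge_atTop 3]
    with x h1 ht0 hx
  have h2 := hB₂ _ ht0
  have h3 := hB₃ x hx
  have hsum : ∑ p ∈ Nat.primesBelow (⌊x⌋₊ + 1), (A p).trace * ((p : ℝ)⁻¹ : ℝ) =
      ∑ p ∈ Nat.primesBelow (⌊x⌋₊ + 1), (∑ i, e p i) * ((p : ℝ)⁻¹ : ℝ) :=
    Finset.sum_congr rfl fun p hp ↦ by rw [htr p (Nat.prime_of_mem_primesBelow hp)]
  rw [hsum]
  set U := ∑ p ∈ Nat.primesBelow (⌊x⌋₊ + 1), (∑ i, e p i) * ((p : ℝ)⁻¹ : ℝ)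
  set V := ∑' p : Nat.Primes, (∑ i, e p i) * ((p : ℝ) ^ (-1 - 1 / Real.log x) : ℝ)
  have hlog : Real.log (1 / Real.log x) = -Real.log (Real.log x) := by
    rw [one_div, Real.log_inv]
  have hdecomp : U - poleOrderAt L 1 * (Real.log (Real.log x) : ℝ) =
      (F (1 / Real.log x) - n * (Real.log (1 / Real.log x) : ℝ)) -
        (F (1 / Real.log x) - V) - (V - U) := by
    rw [hlog, poleOrderAt, ← hn]
    push_cast
    ring
  rw [hdecomp]
  exact (norm_sub_le _ _).trans (add_le_add ((norm_sub_le _ _).trans (add_le_add h1 h2)) h3)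

/-! ### The Euler product at `s = 1/2` -/

lemma exists_norm_sum_logEulerFactor_half_sub_le {r : ℕ} {e : ℕ → Fin r → ℂ}
    (he : ∀ p, p.Prime → ∀ i, ‖e p i‖ ≤ 1) :
    ∃ B : ℝ, ∀ n : ℕ,
      ‖∑ p ∈ Nat.primesBelow (n + 1), (logEulerFactor e (1 / 2) p -
        (∑ i, e p i) / ((Real.sqrt (p : ℝ) : ℝ) : ℂ) -
        (∑ i, e p i ^ 2) * ((p : ℝ)⁻¹ : ℝ) / 2)‖ ≤ B := by
  have hs : Summable fun n : ℕ ↦ 2 * r * (n : ℝ) ^ (-(3 / 2) : ℝ) :=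
    (Real.summable_nat_rpow.mpr (by norm_num)).mul_left _
  refine ⟨∑' n : ℕ, 2 * r * (n : ℝ) ^ (-(3 / 2) : ℝ), fun n ↦ ?_⟩
  refine (norm_sum_le_of_le _ fun p hp ↦ ?_).trans
    (hs.sum_le_tsum (Nat.primesBelow (n + 1)) fun p _ ↦ by positivity)
  have hp := Nat.prime_of_mem_primesBelow hp
  have hp0 : (0 : ℝ) ≤ p := Nat.cast_nonneg p
  have h := norm_logEulerFactor_sub_sub_le (s := 1 / 2) (he p hp) hp (by norm_num)
  have hcpow : (p : ℂ) ^ (-(1 / 2) : ℂ) = ((Real.sqrt p : ℝ) : ℂ)⁻¹ := by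
    rw [Complex.cpow_neg, Real.sqrt_eq_rpow, Complex.ofReal_cpow hp0]
    norm_num
  have hsq : (((Real.sqrt p : ℝ) : ℂ)⁻¹) ^ 2 = ((p : ℝ)⁻¹ : ℝ) := by
    rw [← Complex.ofReal_inv, ← Complex.ofReal_pow, inv_pow, Real.sq_sqrt hp0]
  have hcube : ((p : ℝ) ^ (-(1 / 2 : ℂ).re)) ^ 3 = (p : ℝ) ^ (-(3 / 2) : ℝ) := by
    rw [← Real.rpow_natCast, ← Real.rpow_mul hp0]
    norm_num
  rw [hcube, hcpow, hsq, ← Finset.sum_div] at h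
  convert! h using 2
  ring

lemma exists_norm_sum_logEulerFactor_half_le {r : ℕ} {e : ℕ → Fin r → ℂ}
    (he : ∀ p, p.Prime → ∀ i, ‖e p i‖ ≤ 1) {A : ℕ → Matrix (Fin r) (Fin r) ℂ}
    (hdet : ∀ p, p.Prime → ∀ z : ℂ, (1 - z • A p).det = ∏ i, (1 - z * e p i))
    {c : ℂ} (hc : c ≠ 0)
    (hlim : Tendsto (fun x : ℝ ↦ partialEulerProduct A (1 / 2) x) atTop (𝓝 c)) :
    ∃ B : ℝ, ∀ n : ℕ, ‖∑ p ∈ Nat.primesBelow (n + 1), logEulerFactor e (1 / 2) p‖ ≤ B := by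
  refine exists_norm_le_of_tendsto_exp hc ?_ ?_
  · refine (hlim.comp tendsto_natCast_atTop_atTop).congr fun n ↦ ?_
    rw [Complex.exp_sum, Function.comp, partialEulerProduct, Nat.floor_natCast]
    refine Finset.prod_congr rfl fun p hp ↦ ?_
    have hp := Nat.prime_of_mem_primesBelow hp
    exact (exp_logEulerFactor (he p hp) (hdet p hp) hp (by norm_num)).symm
  · have h0 : Tendsto (fun n : ℕ ↦ 3 * r * ((n + 1 : ℕ) : ℝ) ^ (-(1 / 2) : ℝ)) atTop (𝓝 0) := by
      have := (tendsto_rpow_neg_atTop (y := 1 / 2) (by norm_num)).comp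
        (tendsto_natCast_atTop_atTop.comp (tendsto_add_atTop_nat 1))
      simpa using this.const_mul (3 * (r : ℝ))
    refine squeeze_zero_norm (fun n ↦ ?_) h0
    rw [Nat.primesBelow_succ (n + 1)]
    split_ifs with hp
    · rw [Finset.sum_insert (by simp [Nat.mem_primesBelow]), add_sub_cancel_right]
      simpa using norm_logEulerFactor_le (s := 1 / 2) (he _ hp) hp (by norm_num)
    · rw [sub_self, norm_zero]
      positivity

end DRH

theorem theorem1 {r : ℕ} (M : ℕ → Matrix (Fin r) (Fin r) ℂ) (hM : DRH.IsUnitaryFamily M)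
    (L L₂ : ℂ → ℂ)
    (hL : DRH.IsEntireContinuation M L)
    (hL_half : L (1 / 2) ≠ 0)
    (hL₂ : DRH.IsMeromorphicContinuationAtOne (fun p => M p ^ 2) L₂)
    (hDRH : DRH.DeepRiemannHypothesis M L L₂) :
    Tendsto
      (fun x : ℝ =>
        (∑ p ∈ Nat.primesBelow (⌊x⌋₊ + 1), (M p).trace / ((Real.sqrt (p : ℝ) : ℝ) : ℂ)) /
          ((Real.log (Real.log x) : ℝ) : ℂ))
      atTop (𝓝 (-(DRH.poleOrderAt L₂ 1 : ℂ) / 2)) := by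
  have hex (p : ℕ) : ∃ e : Fin r → ℂ, p.Prime → (∀ i, ‖e i‖ ≤ 1) ∧ (M p).trace = ∑ i, e i ∧
      (M p ^ 2).trace = ∑ i, e i ^ 2 ∧ ∀ z : ℂ, (1 - z • M p).det = ∏ i, (1 - z * e i) := by
    by_cases hp : p.Prime
    · obtain ⟨e, h⟩ := DRH.exists_eigenvalues (hM.unitary_or_zero p hp)
      exact ⟨e, fun _ ↦ h⟩
    · exact ⟨0, fun h ↦ absurd h hp⟩
  choose e he' using hex
  have he (p : ℕ) (hp : p.Prime) := (he' p hp).1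
  have htr (p : ℕ) (hp : p.Prime) := (he' p hp).2.1
  have htr2 (p : ℕ) (hp : p.Prime) := (he' p hp).2.2.1
  have hdet (p : ℕ) (hp : p.Prime) := (he' p hp).2.2.2
  have hc : ((Real.sqrt 2 : ℝ) : ℂ) ^ (DRH.poleOrderAt L₂ 1) * L (1 / 2) ≠ 0 :=
    mul_ne_zero (zpow_ne_zero _ (by simp)) hL_half
  obtain ⟨B₁, hB₁⟩ := DRH.exists_norm_sum_logEulerFactor_half_le he hdet hc hDRH
  obtain ⟨B₂, hB₂⟩ := DRH.exists_norm_sum_logEulerFactor_half_sub_le he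
  obtain ⟨B₃, hB₃⟩ := DRH.exists_norm_sum_trace_div_sub_le (fun p hp ↦ hM.sq hp) hL₂
  set δ : ℂ := (DRH.poleOrderAt L₂ 1 : ℂ) with hδ
  have hll : Tendsto (fun x : ℝ ↦ Real.log (Real.log x)) atTop atTop :=
    Real.tendsto_log_atTop.comp Real.tendsto_log_atTop
  have hbound : ∀ᶠ x : ℝ in atTop,
      ‖(∑ p ∈ Nat.primesBelow (⌊x⌋₊ + 1), (M p).trace / ((Real.sqrt (p : ℝ) : ℝ) : ℂ)) /
          ((Real.log (Real.log x) : ℝ) : ℂ) - -δ / 2‖ ≤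
        (B₁ + B₂ + B₃ / 2) / Real.log (Real.log x) := by
    filter_upwards [hB₃, hll.eventually_gt_atTop 0] with x h3 hx
    have h1 := hB₁ ⌊x⌋₊
    have h2 := hB₂ ⌊x⌋₊
    have hsum1 : ∑ p ∈ Nat.primesBelow (⌊x⌋₊ + 1), (∑ i, e p i) / ((Real.sqrt (p : ℝ) : ℝ) : ℂ) =
        ∑ p ∈ Nat.primesBelow (⌊x⌋₊ + 1), (M p).trace / ((Real.sqrt (p : ℝ) : ℝ) : ℂ) :=
      Finset.sum_congr rfl fun p hp ↦ by rw [htr p (Nat.prime_of_mem_primesBelow hp)]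
    have hsum2 : ∑ p ∈ Nat.primesBelow (⌊x⌋₊ + 1), (∑ i, e p i ^ 2) * (((p : ℝ)⁻¹ : ℝ) : ℂ) =
        ∑ p ∈ Nat.primesBelow (⌊x⌋₊ + 1), (M p ^ 2).trace * (((p : ℝ)⁻¹ : ℝ) : ℂ) :=
      Finset.sum_congr rfl fun p hp ↦ by rw [htr2 p (Nat.prime_of_mem_primesBelow hp)]
    rw [Finset.sum_sub_distrib, Finset.sum_sub_distrib, ← Finset.sum_div, hsum1, hsum2] at h2
    set S := ∑ p ∈ Nat.primesBelow (⌊x⌋₊ + 1), DRH.logEulerFactor e (1 / 2) p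
    set T := ∑ p ∈ Nat.primesBelow (⌊x⌋₊ + 1), (M p).trace / ((Real.sqrt (p : ℝ) : ℝ) : ℂ)
    set U := ∑ p ∈ Nat.primesBelow (⌊x⌋₊ + 1), (M p ^ 2).trace * (((p : ℝ)⁻¹ : ℝ) : ℂ)
    have hne : ((Real.log (Real.log x) : ℝ) : ℂ) ≠ 0 := by exact_mod_cast hx.ne'
    have hdecomp : T / ((Real.log (Real.log x) : ℝ) : ℂ) - -δ / 2 =
        (S - (S - T - U / 2) - (U - δ * (Real.log (Real.log x) : ℝ)) / 2) /
          ((Real.log (Real.log x) : ℝ) : ℂ) := by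
      field_simp
      ring
    rw [hdecomp, norm_div, Complex.norm_real, Real.norm_of_nonneg hx.le]
    gcongr
    refine (norm_sub_le _ _).trans (add_le_add ((norm_sub_le _ _).trans (add_le_add h1 h2)) ?_)
    rw [norm_div, Complex.norm_ofNat]
    gcongr
  rw [tendsto_iff_norm_sub_tendsto_zero]
  exact squeeze_zero' (Eventually.of_forall fun _ ↦ norm_nonneg _) hbound
    (hll.const_div_atTop _)
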